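/- Let $V$ be a finite-dimensional complex vector space and let $W$ be a complex reflection group acting irreducibly on $V$, i.e. a finite group acting faithfully and irreducibly on $V$ and generated by elements acting as complex reflections (elements whose fixed space is a hyperplane). Let $S=\mathbb{C}[V]=\mathrm{Sym}_{\mathbb{C}}(V^*)$ be the ring of polynomials on $V$, with its natural action of $W$ and with $S^W$ its ring of invariants. Let $S^*=\mathrm{Sym}_{\mathbb{C}}(V)$ act on $S$ by constant coefficient differential operators, where $u\in V$ acts as the directional derivative $\partial_u$, and let $H\subseteq S$ be the $W$-stable subspace of harmonic polynomials, that is, of those $f\in S$ with $Df=0$ for every $W$-invariant $D\in S^*$ without constant term. For a finite-dimensional complex representation $M$ of $W$ with dual $M^*$, consider the pairing \[ \mathrm{Hom}_W(M,H)\otimes \mathrm{Hom}_W(M^*,H)\to \mathrm{Hom}_W(M\otimes M^*,S)\to \mathrm{Hom}_W(\mathbb{C},S)=S^W , \] where the first map sends $\varphi\otimes\psi$ to $m\otimes\xi\mapsto \varphi(m)\psi(\xi)$ and the second is composition with the $W$-invariant diagonal $\mathbb{C}\to M\otimes M^*$, $1\mapsto\sum_i e_i\otimes e_i^*$ (for a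 basis $(e_i)$ of $M$ with dual basis $(e_i^*)$). Let $v\in V$ be a regular vector, that is, a vector lying on none of the reflecting hyperplanes of $W$ (the fixed hyperplanes of the complex reflections in $W$). Then for every such $M$ the composite with evaluation at $v$, \[ \mathrm{Hom}_W(M,H)\otimes \mathrm{Hom}_W(M^*,H)\to S^W\xrightarrow{\ \mathrm{ev}_v\ }\mathbb{C}, \] is a perfect pairing. -/

import Mathlib

open scoped TensorProduct

noncomputable section

namespace ReflectionGroup

open Module

section Sym

variable {G U : Type*} [Group G] [AddCommGroup U] [Module ℂ U]

/-- The functorial action of `G` by graded algebra automorphisms on the symmetric algebra of a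
representation `U`: it extends the action on `U`. -/
def symRep (ρ : Representation ℂ G U) : Representation ℂ G (SymmetricAlgebra ℂ U) where
  toFun g := (SymmetricAlgebra.lift (SymmetricAlgebra.ι ℂ U ∘ₗ ρ g)).toLinearMap
  map_one' := by
    rw [map_one, Module.End.one_eq_id, LinearMap.comp_id, SymmetricAlgebra.lift_ι]
    rfl
  map_mul' g h := by
    rw [Module.End.mul_eq_comp, ← AlgHom.comp_toLinearMap]
    congr 1
    apply SymmetricAlgebra.algHom_ext
    ext u
    simp

@[simp]
theorem symRep_ι (ρ : Representation ℂ G U) (g : G) (u : U) :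
    symRep ρ g (SymmetricAlgebra.ι ℂ U u) = SymmetricAlgebra.ι ℂ U (ρ g u) := by
  simp [symRep]

@[simp]
theorem symRep_mul (ρ : Representation ℂ G U) (g : G) (a b : SymmetricAlgebra ℂ U) :
    symRep ρ g (a * b) = symRep ρ g a * symRep ρ g b := by
  simp [symRep]

@[simp]
theorem symRep_algebraMap (ρ : Representation ℂ G U) (g : G) (r : ℂ) :
    symRep ρ g (algebraMap ℂ _ r) = algebraMap ℂ _ r := by
  simp [symRep]

end Sym

section Polynomials

variable (V : Type*) [AddCommGroup V] [Module ℂ V]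

/-- The ring `S = ℂ[V] = Sym(V*)` of polynomials on `V`. -/
abbrev PolyRing : Type _ := SymmetricAlgebra ℂ (Dual ℂ V)

variable {V}

/-- Evaluation of polynomials at a vector `v`. -/
def ev (v : V) : PolyRing V →ₐ[ℂ] ℂ := SymmetricAlgebra.lift (Dual.eval ℂ V v)

/-- First order Taylor expansion `f ↦ f + ε ∂ᵥf`, as an algebra homomorphism. -/
def taylor (v : V) : PolyRing V →ₐ[ℂ] DualNumber (PolyRing V) :=
  SymmetricAlgebra.lift
    { toFun := fun φ => TrivSqZeroExt.inl (SymmetricAlgebra.ι ℂ (Dual ℂ V) φ) +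
        TrivSqZeroExt.inr (algebraMap ℂ (PolyRing V) (φ v))
      map_add' := fun φ ψ => by
        ext <;> simp only [TrivSqZeroExt.fst_add, TrivSqZeroExt.snd_add, TrivSqZeroExt.fst_inl,
          TrivSqZeroExt.fst_inr, TrivSqZeroExt.snd_inl, TrivSqZeroExt.snd_inr, map_add,
          LinearMap.add_apply, add_zero, zero_add]
      map_smul' := fun r φ => by
        rw [map_smul, LinearMap.smul_apply, smul_eq_mul, map_mul, ← Algebra.smul_def,
          TrivSqZeroExt.inl_smul, TrivSqZeroExt.inr_smul, RingHom.id_apply, smul_add] }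

/-- The directional derivative `∂ᵥ : S → S`: the derivation of `S` sending each linear form `φ` to
the constant `φ v` (see `partialDeriv_ι` and `partialDeriv_mul`). -/
def partialDeriv (v : V) : Module.End ℂ (PolyRing V) :=
  TrivSqZeroExt.sndHom (PolyRing V) (PolyRing V) |>.restrictScalars ℂ |>.comp (taylor v).toLinearMap

theorem taylor_fst (v : V) (f : PolyRing V) : (taylor v f).fst = f := by
  have : (TrivSqZeroExt.fstHom ℂ (PolyRing V) (PolyRing V)).comp (taylor v) = AlgHom.id ℂ (PolyRing V) := by
    apply SymmetricAlgebra.algHom_ext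
    ext φ
    simp [taylor]
  exact DFunLike.congr_fun this f

@[simp]
theorem partialDeriv_ι (v : V) (φ : Dual ℂ V) :
    partialDeriv v (SymmetricAlgebra.ι ℂ _ φ) = algebraMap ℂ (PolyRing V) (φ v) := by
  simp only [partialDeriv, taylor, LinearMap.comp_apply, AlgHom.toLinearMap_apply,
    SymmetricAlgebra.lift_ι_apply]
  simp [Algebra.algebraMap_eq_smul_one]

@[simp]
theorem partialDeriv_algebraMap (v : V) (r : ℂ) :
    partialDeriv v (algebraMap ℂ (PolyRing V) r) = 0 := by
  simp [partialDeriv, TrivSqZeroExt.algebraMap_eq_inl']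

@[simp]
theorem partialDeriv_mul (v : V) (f g : PolyRing V) :
    partialDeriv v (f * g) = f * partialDeriv v g + partialDeriv v f * g := by
  simp [partialDeriv, taylor_fst, mul_comm]

theorem partialDeriv_comm (v w : V) :
    partialDeriv v * partialDeriv w = partialDeriv w * partialDeriv v := by
  ext f
  simp only [Module.End.mul_apply]
  induction f using SymmetricAlgebra.induction with
  | algebraMap r => simp
  | ι φ => simp
  | mul a b ha hb => simp [ha, hb]; ring
  | add a b ha hb => simp [ha, hb]

variable (V) in
/-- The derivative `∂ᵥ` as a linear function of `v`. -/
def partialDerivHom : V →ₗ[ℂ] Module.End ℂ (PolyRing V) where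
  toFun := partialDeriv
  map_add' v w := by
    ext f
    induction f using SymmetricAlgebra.induction with
    | algebraMap r => simp
    | ι φ => simp
    | mul a b ha hb => simp_all; ring
    | add a b ha hb => simp_all; abel
  map_smul' r v := by
    ext f
    induction f using SymmetricAlgebra.induction with
    | algebraMap s => simp
    | ι φ => simp [Algebra.smul_def]
    | mul a b ha hb => simp_all
    | add a b ha hb => simp_all

variable (V) in
/-- The commutative algebra of constant coefficient differential operators on `S`, generated by
the directional derivatives. -/
abbrev diffOpAlg : Subalgebra ℂ (Module.End ℂ (PolyRing V)) :=
  Algebra.adjoin ℂ (Set.range (partialDeriv (V := V)))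

instance : CommSemiring (diffOpAlg V) where
  mul_comm :=
    (Algebra.isMulCommutative_adjoin ℂ (s := Set.range (partialDeriv (V := V))) (by
      rintro _ ⟨v, rfl⟩ _ ⟨w, rfl⟩
      exact partialDeriv_comm v w)).is_comm.comm

variable (V) in
/-- The action of `S* = Sym(V)` on `S` by constant coefficient differential operators: the unique
module structure extending the action of `V` by derivations. -/
def diffOp : SymmetricAlgebra ℂ V →ₐ[ℂ] Module.End ℂ (PolyRing V) :=
  (diffOpAlg V).val.comp
    (SymmetricAlgebra.lift
      ((partialDerivHom V).codRestrict (Subalgebra.toSubmodule (diffOpAlg V))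
        fun v => Algebra.subset_adjoin ⟨v, rfl⟩))

@[simp]
theorem diffOp_ι (v : V) : diffOp V (SymmetricAlgebra.ι ℂ V v) = partialDeriv v := by
  simp only [diffOp, AlgHom.comp_apply, SymmetricAlgebra.lift_ι_apply]
  rfl

end Polynomials

section Group

variable {W V : Type*} [Group W] [AddCommGroup V] [Module ℂ V]

/-- The action of `W` on `S = ℂ[V]`, `(g f)(x) = f (g⁻¹ x)`. -/
abbrev polyRep (ρ : Representation ℂ W V) : Representation ℂ W (PolyRing V) := symRep ρ.dual

theorem diffOp_equivariant (ρ : Representation ℂ W V) (g : W) (D : SymmetricAlgebra ℂ V)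
    (f : PolyRing V) :
    diffOp V (symRep ρ g D) (polyRep ρ g f) = polyRep ρ g (diffOp V D f) := by
  induction D using SymmetricAlgebra.induction generalizing f with
  | algebraMap r => simp
  | ι v =>
    simp only [symRep_ι, diffOp_ι]
    induction f using SymmetricAlgebra.induction with
    | algebraMap r => simp
    | ι φ => simp [Module.Dual.transpose_apply, ← Module.End.mul_apply, ← map_mul]
    | mul a b ha hb => simp [ha, hb]
    | add a b ha hb => simp [ha, hb]
  | mul a b ha hb => simp [ha, hb]
  | add a b ha hb => simp [ha, hb]

/-- The space `H` of harmonic polynomials: the polynomials killed by every `W`-invariant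
differential operator in `(S*)^W` without constant term, with its action of `W`. -/
def harmonic (ρ : Representation ℂ W V) : Subrepresentation (polyRep ρ) where
  toSubmodule :=
    ⨅ D ∈ {D : SymmetricAlgebra ℂ V |
      D ∈ (symRep ρ).invariants ∧ SymmetricAlgebra.algebraMapInv D = 0},
      LinearMap.ker (diffOp V D)
  apply_mem_toSubmodule g f hf := by
    simp only [Submodule.mem_iInf, LinearMap.mem_ker] at hf ⊢
    intro D hD
    have h := diffOp_equivariant ρ g D f
    rw [hD.1 g, hf D hD, map_zero] at h
    exact h

theorem mem_harmonic (ρ : Representation ℂ W V) (f : PolyRing V) :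
    f ∈ (harmonic ρ).toSubmodule ↔
      ∀ D : SymmetricAlgebra ℂ V, D ∈ (symRep ρ).invariants →
        SymmetricAlgebra.algebraMapInv D = 0 → diffOp V D f = 0 := by
  simp [harmonic]

/-- The representation of `W` on the space `H` of harmonic polynomials. -/
abbrev harmonicRep (ρ : Representation ℂ W V) : Representation ℂ W (harmonic ρ).toSubmodule :=
  (harmonic ρ).toRepresentation

/-- `g` acts on `V` as a complex reflection: its fixed space is a hyperplane. (For `g` in a finite
group the usual requirement of finite order is automatic.) -/
def IsReflection (ρ : Representation ℂ W V) (g : W) : Prop :=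
  finrank ℂ (LinearMap.ker (ρ g - 1)) + 1 = finrank ℂ V

/-- `ρ` realises `W` as a complex reflection group on `V`, acting irreducibly: `W` is finite, acts
faithfully and irreducibly, and is generated by the elements acting as complex reflections. -/
structure IsIrreducibleReflectionGroup (ρ : Representation ℂ W V) : Prop where
  finite : Finite W
  faithful : Function.Injective ρ
  irreducible : ρ.IsIrreducible
  generated : Subgroup.closure {g : W | IsReflection ρ g} = ⊤

/-- A vector is regular if it lies on no reflecting hyperplane `V^g`, `g` a complex reflection
in `W`. -/
def IsRegular (ρ : Representation ℂ W V) (v : V) : Prop :=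
  ∀ g : W, IsReflection ρ g → v ∉ LinearMap.ker (ρ g - 1)

variable {M : Type*} [AddCommGroup M] [Module ℂ M]

/-- The map `Hom_W(M, H) ⊗ Hom_W(M*, H) → Hom_W(M ⊗ M*, S)`, given by
`φ ⊗ ψ ↦ (m ⊗ ξ ↦ φ(m) ψ(ξ))`. -/
def productHom (ρ : Representation ℂ W V) (τ : Representation ℂ W M)
    (φ : τ.IntertwiningMap (harmonicRep ρ)) (ψ : τ.dual.IntertwiningMap (harmonicRep ρ)) :
    (τ.tprod τ.dual).IntertwiningMap (polyRep ρ) where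
  toLinearMap := LinearMap.mul' ℂ (PolyRing V) ∘ₗ
    TensorProduct.map ((harmonic ρ).toSubmodule.subtype ∘ₗ φ.toLinearMap)
      ((harmonic ρ).toSubmodule.subtype ∘ₗ ψ.toLinearMap)
  isIntertwining' g := by
    apply TensorProduct.ext'
    intro m ξ
    have h1 := congrArg Subtype.val (φ.isIntertwining _ _ g m)
    have h2 := congrArg Subtype.val (ψ.isIntertwining _ _ g ξ)
    simp only [LinearMap.comp_apply, TensorProduct.map_tmul, Representation.tprod_apply,
      LinearMap.mul'_apply, Submodule.subtype_apply,
      Representation.IntertwiningMap.toLinearMap_apply, symRep_mul]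
    exact congrArg₂ (· * ·) h1 h2

variable [FiniteDimensional ℂ M]

/-- The diagonal element `∑ᵢ eᵢ ⊗ eᵢ*` of `M ⊗ M*` is invariant. -/
theorem coevaluation_mem_invariants (τ : Representation ℂ W M) :
    coevaluation ℂ M 1 ∈ (τ.tprod τ.dual).invariants := by
  intro g
  let e : M ⊗[ℂ] Dual ℂ M →ₗ[ℂ] M →ₗ[ℂ] M :=
    dualTensorHom ℂ M M ∘ₗ (TensorProduct.comm ℂ M (Dual ℂ M)).toLinearMap
  have he : Function.Injective e :=
    (dualTensorHom_bijective (R := ℂ) (M := M) (N := M)).1.comp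
      (TensorProduct.comm ℂ M (Dual ℂ M)).injective
  have h1 : e (coevaluation ℂ M 1) = LinearMap.id := by
    rw [coevaluation_apply_one]
    ext m
    simpa [e] using (Basis.ofVectorSpace ℂ M).sum_repr m
  have h2 : ∀ x, e ((τ.tprod τ.dual) g x) = τ g ∘ₗ e x ∘ₗ τ g⁻¹ := by
    intro x
    induction x with
    | zero => simp
    | tmul m ξ => ext y; simp [e, Module.Dual.transpose_apply]
    | add x y hx hy => rw [map_add, map_add, map_add, hx, hy, LinearMap.add_comp, LinearMap.comp_add]
  apply he
  rw [h2, h1]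
  ext y
  simp [← Module.End.mul_apply, ← map_mul]

/-- The pairing `Hom_W(M, H) ⊗ Hom_W(M*, H) → Hom_W(M ⊗ M*, S) → Hom_W(ℂ, S) = S^W`, where the
second arrow is composition with the diagonal `ℂ → M ⊗ M*`. -/
def pairing (ρ : Representation ℂ W V) (τ : Representation ℂ W M) :
    τ.IntertwiningMap (harmonicRep ρ) →ₗ[ℂ] τ.dual.IntertwiningMap (harmonicRep ρ) →ₗ[ℂ]
      (polyRep ρ).invariants :=
  LinearMap.mk₂ ℂ
    (fun φ ψ => ⟨productHom ρ τ φ ψ (coevaluation ℂ M 1), fun g => by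
      rw [← (productHom ρ τ φ ψ).isIntertwining _ _ g, coevaluation_mem_invariants τ g]⟩)
    (fun φ φ' ψ => by
      ext1
      simp [productHom, coevaluation_apply_one, add_mul, Finset.sum_add_distrib])
    (fun c φ ψ => by
      ext1
      simp [productHom, coevaluation_apply_one, Finset.smul_sum])
    (fun φ ψ ψ' => by
      ext1
      simp [productHom, coevaluation_apply_one, mul_add, Finset.sum_add_distrib])
    (fun c φ ψ => by
      ext1
      simp [productHom, coevaluation_apply_one, Finset.smul_sum])

/-- The pairing followed by evaluation `S^W → ℂ` at `v`. -/
def pairingAt (ρ : Representation ℂ W V) (τ : Representation ℂ W M) (v : V) :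
    τ.IntertwiningMap (harmonicRep ρ) →ₗ[ℂ] τ.dual.IntertwiningMap (harmonicRep ρ) →ₗ[ℂ] ℂ :=
  (pairing ρ τ).compr₂ ((ev v).toLinearMap ∘ₗ (polyRep ρ).invariants.subtype)

end Group

end ReflectionGroup

end

/-!
Write `N = |W|` and `H` for the space of harmonic polynomials. The theorem reduces to one fact: for
a regular vector `v`, restriction to the orbit, `f ↦ (g ↦ f (g⁻¹ v))`, is a `W`-equivariant
isomorphism from `H` onto the functions on `W` (`orbitEval_bijective`). By Frobenius reciprocity
`φ ↦ ev_v ∘ φ` then identifies `Hom_W(M, H)` with `M*` (`homEval_bijective`), likewise `Hom_W(M*, H)` with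
`M**`, and the pairing becomes the evaluation pairing of `M*` with `M**` (`pairingAt_apply`).

The proof of the isomorphism uses two properties of `H`.

* `S = S^W · H` (`eq_top_of_harmonic_le`). A `W`-invariant inner product on `V` gives the positive
  definite form `⟨f, h⟩ = (f̄(∂) h)(0)` on `S`, for which multiplication by `f` is adjoint to
  `f̄(∂)`. Hence `H` is the orthogonal complement of the ideal `I` generated by the invariants
  without constant term, and the claim follows by induction on the degree.
* `dim H ≤ N` (`card_le_of_linearIndependent_harmonic`), the part of Chevalley's theorem that needs
  reflections. If `(D f)(0) = 0` for all `D` in the algebra generated by the divided differences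
  `f ↦ (f - s f) / α_s`, then `f` lies in `I` (`mem_invariantIdeal_of_dividedDifference`): by
  induction on the degree the differences `f - s f` lie in `I`, so `f` is congruent modulo `I` to its average
  over `W`. So for linearly independent `h_j` in `H` there are such operators `D_i` with
  `(D_i h_j)(0) = δ_ij`. A relation `∑ c_j g(h_j) = 0` over `S`, valid for all `g`, is inherited by the
  `D_i h_j`, and forces `c = 0` because the matrix `(D_i h_j)` is invertible at the origin. Hence
  there are at most `N` of the `h_j`.

Let `q` be a homomorphism from `S` to a domain whose translates `q ∘ g` are distinct. By Dedekind
they are linearly independent on `S`, hence on `H` as `S = S^W · H` (`eq_zero_of_forall_basis`).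
With `q` the identity this gives `dim H = N`, and `det (g h_k) ≠ 0` for a basis `(h_k)` of `H`. With
`q` the reduction modulo a prime `p` it shows that `p` divides the determinant only if some `g ≠ 1`
acts trivially modulo `p`, and then `g` is a reflection with hyperplane `p = 0`
(`eq_one_of_prime_dvd`). So the determinant does not vanish at a regular vector. In particular the
freeness of the orbit of `v` (Steinberg's theorem) is a consequence and not an ingredient.
-/

noncomputable section

namespace ReflectionGroup

open Module

/-! ### The grading of the polynomial ring -/

section Grading

variable {V : Type*} [AddCommGroup V] [Module ℂ V]

variable (V) in
/-- The algebra homomorphism `f(x) ↦ f(t x)` from `S` to `S[t]`. It encodes the grading of `S`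
without coordinates: the coefficient of `t ^ d` is the homogeneous component of degree `d`, and the
degree in `t` is the total degree. -/
def dilation : PolyRing V →ₐ[ℂ] Polynomial (PolyRing V) :=
  SymmetricAlgebra.lift
    { toFun := fun φ => Polynomial.monomial 1 (SymmetricAlgebra.ι ℂ (Dual ℂ V) φ)
      map_add' := fun φ ψ => by simp
      map_smul' := fun r φ => by rw [map_smul, RingHom.id_apply, Polynomial.smul_monomial] }

@[simp]
theorem dilation_ι (φ : Dual ℂ V) :
    dilation V (SymmetricAlgebra.ι ℂ _ φ) =
      Polynomial.monomial 1 (SymmetricAlgebra.ι ℂ (Dual ℂ V) φ) := by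
  simp [dilation]

theorem eval_one_dilation (f : PolyRing V) : (dilation V f).eval 1 = f := by
  induction f using SymmetricAlgebra.induction with
  | algebraMap r => simp [Polynomial.algebraMap_apply]
  | ι φ => simp
  | mul a b ha hb => simp [ha, hb]
  | add a b ha hb => simp [ha, hb]

theorem coeff_zero_dilation (f : PolyRing V) :
    (dilation V f).coeff 0 = algebraMap ℂ (PolyRing V) (ev 0 f) := by
  induction f using SymmetricAlgebra.induction with
  | algebraMap r => simp [Polynomial.algebraMap_apply]
  | ι φ => simp [ev, Polynomial.coeff_monomial]
  | mul a b ha hb => simp [Polynomial.mul_coeff_zero, ha, hb]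
  | add a b ha hb => simp [ha, hb]

variable (V) in
/-- The projection of `S` onto its homogeneous component of degree `d`. -/
def component (d : ℕ) : Module.End ℂ (PolyRing V) :=
  (Polynomial.lcoeff (PolyRing V) d).restrictScalars ℂ ∘ₗ (dilation V).toLinearMap

theorem component_apply (d : ℕ) (f : PolyRing V) : component V d f = (dilation V f).coeff d := rfl

theorem component_zero (f : PolyRing V) :
    component V 0 f = algebraMap ℂ (PolyRing V) (ev 0 f) := coeff_zero_dilation f

theorem component_mul (d : ℕ) (f g : PolyRing V) :
    component V d (f * g) =
      ∑ p ∈ Finset.HasAntidiagonal.antidiagonal d, component V p.1 f * component V p.2 g := by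
  simp [component_apply, Polynomial.coeff_mul]

theorem dilation_component (d : ℕ) (f : PolyRing V) :
    dilation V (component V d f) = Polynomial.monomial d (component V d f) := by
  induction f using SymmetricAlgebra.induction generalizing d with
  | algebraMap r =>
    rw [component_apply, AlgHom.commutes, Polynomial.algebraMap_apply, Polynomial.coeff_C]
    split_ifs with h
    · rw [AlgHom.commutes, h, Polynomial.algebraMap_apply, Polynomial.monomial_zero_left]
    · simp
  | ι φ =>
    rw [component_apply, dilation_ι, Polynomial.coeff_monomial]
    split_ifs with h
    · rw [dilation_ι, h]
    · simp
  | mul a b ha hb =>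
    rw [component_mul, map_sum, map_sum]
    refine Finset.sum_congr rfl fun p hp => ?_
    rw [map_mul, ha, hb, Polynomial.monomial_mul_monomial,
      Finset.HasAntidiagonal.mem_antidiagonal.1 hp]
  | add a b ha hb => simp [ha, hb]

theorem component_component_self (d : ℕ) (f : PolyRing V) :
    component V d (component V d f) = component V d f := by
  rw [component_apply, dilation_component, Polynomial.coeff_monomial_same]

theorem ev_zero_component {d : ℕ} (hd : d ≠ 0) (f : PolyRing V) :
    ev 0 (component V d f) = 0 := by
  have h := coeff_zero_dilation (component V d f)
  rw [dilation_component, Polynomial.coeff_monomial_of_ne _ hd.symm] at h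
  exact (SymmetricAlgebra.algebraMap_eq_zero_iff _ _).1 h.symm

theorem sum_component (f : PolyRing V) :
    ∑ d ∈ Finset.range ((dilation V f).natDegree + 1), component V d f = f := by
  conv_rhs => rw [← eval_one_dilation f, Polynomial.eval_eq_sum_range]
  simp [component_apply]

theorem dilation_injective : Function.Injective (dilation V) := fun a b h => by
  rw [← eval_one_dilation a, h, eval_one_dilation]

theorem eq_algebraMap_of_natDegree_dilation_eq_zero {f : PolyRing V}
    (hf : (dilation V f).natDegree = 0) : f = algebraMap ℂ (PolyRing V) (ev 0 f) := by
  have h := sum_component f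
  rw [hf] at h
  simpa [component_zero] using h.symm

variable {W : Type*} [Group W]

theorem component_polyRep (ρ : Representation ℂ W V) (g : W) (f : PolyRing V) (d : ℕ) :
    component V d (polyRep ρ g f) = polyRep ρ g (component V d f) := by
  simp only [component_apply]
  induction f using SymmetricAlgebra.induction generalizing d with
  | algebraMap r =>
    simp only [symRep_algebraMap, AlgHom.commutes, Polynomial.algebraMap_apply,
      Polynomial.coeff_C]
    split_ifs <;> simp
  | ι φ =>
    simp only [symRep_ι, dilation_ι, Polynomial.coeff_monomial]
    split_ifs <;> simp
  | mul a b ha hb => simp [Polynomial.coeff_mul, ha, hb]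
  | add a b ha hb => simp [ha, hb]

theorem natDegree_dilation_polyRep_le (ρ : Representation ℂ W V) (g : W) (f : PolyRing V) :
    (dilation V (polyRep ρ g f)).natDegree ≤ (dilation V f).natDegree := by
  rw [Polynomial.natDegree_le_iff_coeff_eq_zero]
  intro d hd
  rw [← component_apply, component_polyRep, component_apply,
    Polynomial.coeff_eq_zero_of_natDegree_lt hd, map_zero]

theorem ev_polyRep (ρ : Representation ℂ W V) (g : W) (f : PolyRing V) (v : V) :
    ev v (polyRep ρ g f) = ev (ρ g⁻¹ v) f := by
  induction f using SymmetricAlgebra.induction with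
  | algebraMap r => simp
  | ι φ => simp [ev, Module.Dual.transpose_apply]
  | mul a b ha hb => simp [ha, hb]
  | add a b ha hb => simp [ha, hb]

end Grading

/-! ### Linear forms are irreducible -/

section LinearForms

variable {V : Type*} [AddCommGroup V] [Module ℂ V]

theorem ι_injective : Function.Injective (SymmetricAlgebra.ι ℂ (Dual ℂ V)) := by
  rw [injective_iff_map_eq_zero]
  intro φ h
  ext v
  have := congrArg (ev v) h
  simpa [ev] using this

theorem ι_ne_zero {φ : Dual ℂ V} (hφ : φ ≠ 0) :
    SymmetricAlgebra.ι ℂ (Dual ℂ V) φ ≠ 0 :=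
  (map_ne_zero_iff _ ι_injective).2 hφ

theorem natDegree_dilation_ι {φ : Dual ℂ V} (hφ : φ ≠ 0) :
    (dilation V (SymmetricAlgebra.ι ℂ _ φ)).natDegree = 1 := by
  rw [dilation_ι, Polynomial.natDegree_monomial_eq _ (ι_ne_zero hφ)]

instance : UniqueFactorizationMonoid (PolyRing V) :=
  (SymmetricAlgebra.equivMvPolynomial
    (Basis.ofVectorSpace ℂ (Dual ℂ V))).toMulEquiv.symm.uniqueFactorizationMonoid inferInstance

theorem natDegree_dilation_mul {f g : PolyRing V} (hf : f ≠ 0) (hg : g ≠ 0) :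
    (dilation V (f * g)).natDegree = (dilation V f).natDegree + (dilation V g).natDegree := by
  rw [map_mul, Polynomial.natDegree_mul ((map_ne_zero_iff _ dilation_injective).2 hf)
    ((map_ne_zero_iff _ dilation_injective).2 hg)]

theorem isUnit_of_natDegree_dilation_eq_zero {f : PolyRing V} (hf0 : f ≠ 0)
    (hf : (dilation V f).natDegree = 0) : IsUnit f := by
  have h := eq_algebraMap_of_natDegree_dilation_eq_zero hf
  rw [h]
  refine (IsUnit.mk0 _ fun h0 => hf0 ?_).map (algebraMap ℂ (PolyRing V))
  rw [h, h0, map_zero]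

theorem natDegree_dilation_eq_zero_of_isUnit {f : PolyRing V} (hf : IsUnit f) :
    (dilation V f).natDegree = 0 :=
  Polynomial.natDegree_eq_zero_of_isUnit (hf.map (dilation V))

theorem irreducible_ι {φ : Dual ℂ V} (hφ : φ ≠ 0) :
    Irreducible (SymmetricAlgebra.ι ℂ (Dual ℂ V) φ) := by
  refine ⟨fun h => ?_, fun a b hab => ?_⟩
  · have := natDegree_dilation_eq_zero_of_isUnit h
    rw [natDegree_dilation_ι hφ] at this
    exact one_ne_zero this
  · have h0 := ι_ne_zero hφ
    rw [hab] at h0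
    have ha := left_ne_zero_of_mul h0
    have hb := right_ne_zero_of_mul h0
    have h1 := natDegree_dilation_ι hφ
    rw [hab, natDegree_dilation_mul ha hb] at h1
    rcases Nat.add_eq_one_iff.1 h1 with h | h
    · exact Or.inl (isUnit_of_natDegree_dilation_eq_zero ha h.1)
    · exact Or.inr (isUnit_of_natDegree_dilation_eq_zero hb h.2)

theorem exists_smul_eq_of_ι_dvd_ι {φ ψ : Dual ℂ V}
    (h : SymmetricAlgebra.ι ℂ (Dual ℂ V) φ ∣ SymmetricAlgebra.ι ℂ (Dual ℂ V) ψ) :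
    ∃ c : ℂ, ψ = c • φ := by
  obtain rfl | hψ := eq_or_ne ψ 0
  · exact ⟨0, by simp⟩
  obtain ⟨u, hu⟩ := h
  have h0 := ι_ne_zero hψ
  rw [hu] at h0
  have hφ : φ ≠ 0 := by
    rintro rfl
    simp at h0
  have hd := natDegree_dilation_mul (left_ne_zero_of_mul h0) (right_ne_zero_of_mul h0)
  rw [← hu, natDegree_dilation_ι hφ, natDegree_dilation_ι hψ] at hd
  have hc := eq_algebraMap_of_natDegree_dilation_eq_zero (f := u) (by omega)
  refine ⟨ev 0 u, ι_injective ?_⟩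
  rw [hu, map_smul, Algebra.smul_def, ← hc, mul_comm]

end LinearForms

/-! ### An invariant Hermitian form on polynomials -/

section Unitary

variable {W V : Type*} [Group W] [AddCommGroup V] [Module ℂ V]

/-- Every element of the group acts by a unitary matrix in the basis `b`: the matrix of `ρ g` is the
conjugate transpose of the matrix of `ρ g⁻¹`. -/
def IsUnitaryBasis {n : ℕ} (ρ : Representation ℂ W V) (b : Basis (Fin n) ℂ V) : Prop :=
  ∀ g i j, b.coord j (ρ g (b i)) = starRingEnd ℂ (b.coord i (ρ g⁻¹ (b j)))

/-- Averaging an inner product over the group and taking an orthonormal basis. -/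
theorem exists_isUnitaryBasis [Finite W] [FiniteDimensional ℂ V] (ρ : Representation ℂ W V) :
    ∃ (n : ℕ) (b : Basis (Fin n) ℂ V), IsUnitaryBasis ρ b := by
  classical
  have := Fintype.ofFinite W
  -- the inner product to average is transported from Euclidean space by any linear isomorphism
  let e : V ≃ₗ[ℂ] EuclideanSpace ℂ (Fin (finrank ℂ V)) :=
    LinearEquiv.ofFinrankEq _ _ (by simp)
  let core : InnerProductSpace.Core ℂ V :=
    { inner := fun x y => ∑ g, inner ℂ (e (ρ g x)) (e (ρ g y))
      conj_inner_symm := fun x y => by simp [map_sum]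
      re_inner_nonneg := fun x => by
        rw [map_sum]
        exact Finset.sum_nonneg fun g _ => inner_self_nonneg
      add_left := fun x y z => by simp [Finset.sum_add_distrib]
      smul_left := fun x y r => by simp [Finset.mul_sum, mul_comm]
      definite := fun x hx => by
        have h := congrArg RCLike.re hx
        rw [map_sum, map_zero,
          Finset.sum_eq_zero_iff_of_nonneg fun g _ => inner_self_nonneg] at h
        have h1 := h 1 (Finset.mem_univ _)
        rwa [map_one, Module.End.one_apply, inner_self_eq_norm_sq, sq_eq_zero_iff, norm_eq_zero,
          LinearEquiv.map_eq_zero_iff] at h1 }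
  let _ : NormedAddCommGroup V := core.toNormedAddCommGroup
  let _ : InnerProductSpace ℂ V := InnerProductSpace.ofCore core.toCore
  have hinner : ∀ x y : V, inner ℂ x y = ∑ g, inner ℂ (e (ρ g x)) (e (ρ g y)) := fun _ _ => rfl
  have hinv : ∀ (g : W) (x y : V), inner ℂ x (ρ g y) = inner ℂ (ρ g⁻¹ x) y := by
    intro g x y
    rw [hinner, hinner]
    refine Fintype.sum_equiv (Equiv.mulRight g) _ _ fun h => ?_
    simp [← Module.End.mul_apply, ← map_mul]
  let b := stdOrthonormalBasis ℂ V
  have hc : ∀ i x, b.toBasis.coord i x = inner ℂ (b i) x := fun i x => by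
    rw [Basis.coord_apply, OrthonormalBasis.coe_toBasis_repr_apply, b.repr_apply_apply]
  refine ⟨_, b.toBasis, fun g i j => ?_⟩
  rw [hc, hc, b.coe_toBasis, inner_conj_symm, hinv]

end Unitary

section Conjugation

variable {V : Type*} [AddCommGroup V] [Module ℂ V] {n : ℕ} (b : Basis (Fin n) ℂ V)

/-- Polynomials on `V` as polynomials in the coordinates of the basis `b`. -/
abbrev coordEquiv : PolyRing V ≃ₐ[ℂ] MvPolynomial (Fin n) ℂ :=
  SymmetricAlgebra.equivMvPolynomial b.dualBasis

theorem coordEquiv_symm_X (i : Fin n) :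
    (coordEquiv b).symm (MvPolynomial.X i) = SymmetricAlgebra.ι ℂ _ (b.coord i) := by
  simp [coordEquiv]

theorem coordEquiv_ι_coord (i : Fin n) :
    coordEquiv b (SymmetricAlgebra.ι ℂ _ (b.coord i)) = MvPolynomial.X i := by
  rw [← coordEquiv_symm_X, AlgEquiv.apply_symm_apply]

/-- The conjugate-linear ring isomorphism `S ≃ S*` that sends the `i`-th coordinate function
to the `i`-th basis vector. -/
def conjEquiv : PolyRing V ≃+* SymmetricAlgebra ℂ V :=
  (coordEquiv b).toRingEquiv.trans
    ((MvPolynomial.mapEquiv (Fin n) starRingAut).trans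
      (SymmetricAlgebra.equivMvPolynomial b).symm.toRingEquiv)

theorem conjEquiv_ι_coord (i : Fin n) :
    conjEquiv b (SymmetricAlgebra.ι ℂ _ (b.coord i)) = SymmetricAlgebra.ι ℂ V (b i) := by
  simp [conjEquiv, coordEquiv_ι_coord]

theorem conjEquiv_algebraMap (c : ℂ) :
    conjEquiv b (algebraMap ℂ _ c) = algebraMap ℂ _ (starRingEnd ℂ c) := by
  change (SymmetricAlgebra.equivMvPolynomial b).symm
    (MvPolynomial.map _ (coordEquiv b (algebraMap ℂ _ c))) = _
  rw [AlgEquiv.commutes, MvPolynomial.algebraMap_eq, MvPolynomial.map_C,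
    ← MvPolynomial.algebraMap_eq]
  exact AlgEquiv.commutes _ _

theorem conjEquiv_smul (c : ℂ) (f : PolyRing V) :
    conjEquiv b (c • f) = starRingEnd ℂ c • conjEquiv b f := by
  rw [Algebra.smul_def, map_mul, conjEquiv_algebraMap, ← Algebra.smul_def]

theorem conjEquiv_ι (φ : Dual ℂ V) :
    conjEquiv b (SymmetricAlgebra.ι ℂ _ φ) =
      ∑ i, starRingEnd ℂ (φ (b i)) • SymmetricAlgebra.ι ℂ V (b i) := by
  have h : φ = ∑ i, φ (b i) • b.coord i := by
    refine b.ext fun j => ?_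
    simp
  conv_lhs => rw [h]
  simp only [map_sum, map_smul, conjEquiv_smul, conjEquiv_ι_coord]

theorem conjEquiv_polyRep {W : Type*} [Group W] {ρ : Representation ℂ W V}
    (hb : IsUnitaryBasis ρ b) (g : W) (f : PolyRing V) :
    conjEquiv b (polyRep ρ g f) = symRep ρ g (conjEquiv b f) := by
  induction f using SymmetricAlgebra.induction with
  | algebraMap r => simp [conjEquiv_algebraMap]
  | ι φ =>
    -- both sides are expanded in the basis; unitarity identifies the two matrices
    have h1 : ∀ i, φ (ρ g⁻¹ (b i)) = ∑ j, b.coord j (ρ g⁻¹ (b i)) * φ (b j) := fun i => by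
      conv_lhs => rw [← b.sum_repr (ρ g⁻¹ (b i))]
      simp only [map_sum, map_smul, smul_eq_mul, Basis.coord_apply]
    have h2 : ∀ j, ρ g (b j) = ∑ i, starRingEnd ℂ (b.coord j (ρ g⁻¹ (b i))) • b i := fun j => by
      conv_lhs => rw [← b.sum_repr (ρ g (b j))]
      simp only [← Basis.coord_apply, hb g j]
    rw [symRep_ι, conjEquiv_ι, conjEquiv_ι]
    simp only [map_sum, map_smul, symRep_ι, h2, Representation.dual_apply,
      Module.Dual.transpose_apply, LinearMap.comp_apply, h1, map_mul, Finset.sum_smul,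
      Finset.smul_sum, smul_smul]
    rw [Finset.sum_comm]
    simp only [mul_comm]
  | mul a b ha hb => simp [ha, hb]
  | add a b ha hb => simp [ha, hb]

theorem algebraMapInv_conjEquiv (f : PolyRing V) :
    SymmetricAlgebra.algebraMapInv (conjEquiv b f) = starRingEnd ℂ (ev 0 f) := by
  induction f using SymmetricAlgebra.induction with
  | algebraMap r => simp [conjEquiv_algebraMap]
  | ι φ => simp [conjEquiv_ι, ev, SymmetricAlgebra.algebraMapInv_ι]
  | mul a b ha hb => simp [ha, hb]
  | add a b ha hb => simp [ha, hb]

theorem coordEquiv_partialDeriv (i : Fin n) (f : PolyRing V) :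
    coordEquiv b (partialDeriv (b i) f) = MvPolynomial.pderiv i (coordEquiv b f) := by
  rw [← (coordEquiv b).symm_apply_apply f]
  induction coordEquiv b f using MvPolynomial.induction_on with
  | C a =>
    rw [← MvPolynomial.algebraMap_eq, AlgEquiv.commutes]
    simp [MvPolynomial.algebraMap_eq]
  | add p q hp hq => simp_all
  | mul_X p j hp =>
    rw [map_mul, partialDeriv_mul, map_add, map_mul, map_mul, hp, coordEquiv_symm_X,
      partialDeriv_ι]
    simp [coordEquiv_ι_coord, Finsupp.single_apply, MvPolynomial.pderiv_X, Pi.single_apply,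
      eq_comm, mul_comm]

theorem ev_zero_eq_coeff (f : PolyRing V) : ev 0 f = MvPolynomial.coeff 0 (coordEquiv b f) := by
  have : (ev (0 : V)).comp (coordEquiv b).symm.toAlgHom =
      MvPolynomial.aeval (fun _ : Fin n => (0 : ℂ)) := by
    ext i
    simp [ev]
  have h := DFunLike.congr_fun this (coordEquiv b f)
  simp only [AlgHom.comp_apply, AlgEquiv.toAlgHom_apply, AlgEquiv.symm_apply_apply] at h
  rw [h]
  simp [MvPolynomial.aeval_def, MvPolynomial.eval₂_zero'_apply, MvPolynomial.constantCoeff_eq]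

theorem coordEquiv_component (d : ℕ) (f : PolyRing V) :
    coordEquiv b (component V d f) = MvPolynomial.homogeneousComponent d (coordEquiv b f) := by
  have hX : ∀ (m : Fin n →₀ ℕ),
      dilation V ((coordEquiv b).symm (MvPolynomial.monomial m 1)) =
        Polynomial.monomial m.degree ((coordEquiv b).symm (MvPolynomial.monomial m 1)) := by
    intro m
    induction m using Finsupp.induction_linear with
    | zero => simp
    | add m₁ m₂ h₁ h₂ =>
      rw [← one_mul (1 : ℂ), ← MvPolynomial.monomial_mul, map_mul, map_mul, h₁, h₂,
        Polynomial.monomial_mul_monomial, map_add]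
    | single i k =>
      rw [← MvPolynomial.X_pow_eq_monomial, map_pow, map_pow, coordEquiv_symm_X, dilation_ι,
        Polynomial.monomial_pow]
      simp
  have : (coordEquiv b).toLinearMap ∘ₗ component V d ∘ₗ (coordEquiv b).symm.toLinearMap =
      MvPolynomial.homogeneousComponent d := by
    refine (MvPolynomial.basisMonomials (Fin n) ℂ).ext fun m => ?_
    simp only [LinearMap.comp_apply, MvPolynomial.coe_basisMonomials, AlgEquiv.toLinearMap_apply,
      component_apply, hX, Polynomial.coeff_monomial, apply_ite (coordEquiv b),
      AlgEquiv.apply_symm_apply, map_zero]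
    ext m'
    rw [MvPolynomial.coeff_homogeneousComponent]
    by_cases hm : m = m'
    · subst hm
      split_ifs <;> simp
    · split_ifs <;> simp [MvPolynomial.coeff_monomial, hm]
  simpa using DFunLike.congr_fun this (coordEquiv b f)

instance finiteDimensional_range_component [FiniteDimensional ℂ V] (d : ℕ) :
    FiniteDimensional ℂ (LinearMap.range (component V d)) := by
  let b := Module.finBasis ℂ V
  have hfg := MvPolynomial.homogeneousSubmodule_fg ℂ (σ := Fin (finrank ℂ V)) d
  have : Module.Finite ℂ (MvPolynomial.homogeneousSubmodule (Fin (finrank ℂ V)) ℂ d) :=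
    Module.Finite.iff_fg.2 hfg
  have hle : LinearMap.range (component V d) ≤
      (MvPolynomial.homogeneousSubmodule (Fin (finrank ℂ V)) ℂ d).comap
        (coordEquiv b).toLinearMap := by
    rintro _ ⟨f, rfl⟩
    simp only [Submodule.mem_comap, AlgEquiv.toLinearMap_apply, coordEquiv_component]
    exact MvPolynomial.homogeneousComponent_isHomogeneous d _
  exact Module.Finite.of_injective
    (((coordEquiv b).toLinearMap.restrict hle) :
      _ →ₗ[ℂ] MvPolynomial.homogeneousSubmodule (Fin (finrank ℂ V)) ℂ d)
    (fun x y h => Subtype.ext ((coordEquiv b).injective (congrArg Subtype.val h)))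

/-- The Hermitian form `⟨f, h⟩ = (f̄(∂) h)(0)` on `S`. -/
def hermForm (f h : PolyRing V) : ℂ := ev 0 (diffOp V (conjEquiv b f) h)

/-- The form pairs a monomial with `h` to a positive multiple of a coefficient of `h`; the multiple
is the product of the factorials of the exponents, of which only positivity matters. -/
theorem exists_hermForm_monomial (m : Fin n →₀ ℕ) :
    ∃ w : ℝ, 0 < w ∧ ∀ h : PolyRing V,
      hermForm b ((coordEquiv b).symm (MvPolynomial.monomial m 1)) h =
        w * MvPolynomial.coeff m (coordEquiv b h) := by
  have step : ∀ (m : Fin n →₀ ℕ) (i : Fin n), (∃ w : ℝ, 0 < w ∧ ∀ h : PolyRing V,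
      hermForm b ((coordEquiv b).symm (MvPolynomial.monomial m 1)) h =
        w * MvPolynomial.coeff m (coordEquiv b h)) → ∃ w : ℝ, 0 < w ∧ ∀ h : PolyRing V,
      hermForm b ((coordEquiv b).symm (MvPolynomial.monomial (m + Finsupp.single i 1) 1)) h =
        w * MvPolynomial.coeff (m + Finsupp.single i 1) (coordEquiv b h) := by
    rintro m i ⟨w, hw, hm⟩
    refine ⟨w * (m i + 1), by positivity, fun h => ?_⟩
    have h1 : MvPolynomial.monomial (m + Finsupp.single i 1) (1 : ℂ) =
        MvPolynomial.monomial m 1 * MvPolynomial.X i := by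
      rw [MvPolynomial.X, MvPolynomial.monomial_mul, one_mul]
    have h2 := hm (partialDeriv (b i) h)
    rw [hermForm, coordEquiv_partialDeriv, MvPolynomial.coeff_pderiv] at h2
    rw [hermForm, h1, map_mul, coordEquiv_symm_X, map_mul, map_mul, conjEquiv_ι_coord, diffOp_ι,
      Module.End.mul_apply, h2]
    push_cast
    ring
  induction m using Finsupp.induction with
  | zero =>
    refine ⟨1, one_pos, fun h => ?_⟩
    simp [hermForm, ev_zero_eq_coeff b]
  | single_add i k m _ _ ih =>
    have key : ∀ k : ℕ, ∃ w : ℝ, 0 < w ∧ ∀ h : PolyRing V,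
        hermForm b ((coordEquiv b).symm (MvPolynomial.monomial (m + Finsupp.single i k) 1)) h =
          w * MvPolynomial.coeff (m + Finsupp.single i k) (coordEquiv b h) := by
      intro k
      induction k with
      | zero => simpa using ih
      | succ k ihk =>
        rw [Finsupp.single_add, ← add_assoc]
        exact step _ _ ihk
    rw [add_comm]
    exact key k

theorem hermForm_add_left (f₁ f₂ h : PolyRing V) :
    hermForm b (f₁ + f₂) h = hermForm b f₁ h + hermForm b f₂ h := by
  simp [hermForm]

theorem hermForm_smul_left (c : ℂ) (f h : PolyRing V) :
    hermForm b (c • f) h = starRingEnd ℂ c * hermForm b f h := by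
  simp [hermForm, conjEquiv_smul]

theorem hermForm_sum_left {ι : Type*} (s : Finset ι) (f : ι → PolyRing V) (h : PolyRing V) :
    hermForm b (∑ i ∈ s, f i) h = ∑ i ∈ s, hermForm b (f i) h := by
  simp [hermForm]

theorem hermForm_mul_left (f₁ f₂ h : PolyRing V) :
    hermForm b (f₁ * f₂) h = hermForm b f₁ (diffOp V (conjEquiv b f₂) h) := by
  simp [hermForm]

/-- Monomials are orthogonal for `hermForm`, and have positive norms. -/
theorem exists_hermForm_eq_sum :
    ∃ w : (Fin n →₀ ℕ) → ℝ, (∀ m, 0 < w m) ∧ ∀ (f h : PolyRing V) (s : Finset (Fin n →₀ ℕ)),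
      (coordEquiv b f).support ⊆ s →
      hermForm b f h = ∑ m ∈ s, starRingEnd ℂ (MvPolynomial.coeff m (coordEquiv b f)) *
        (w m * MvPolynomial.coeff m (coordEquiv b h)) := by
  choose w hw hwf using exists_hermForm_monomial b
  refine ⟨w, hw, fun f h s hs => ?_⟩
  have hf : f = ∑ m ∈ s, MvPolynomial.coeff m (coordEquiv b f) •
      (coordEquiv b).symm (MvPolynomial.monomial m 1) := by
    apply (coordEquiv b).injective
    simp only [map_sum, map_smul, AlgEquiv.apply_symm_apply, MvPolynomial.smul_monomial,
      smul_eq_mul, mul_one]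
    conv_lhs => rw [← MvPolynomial.support_sum_monomial_coeff (coordEquiv b f)]
    refine Finset.sum_subset hs fun m _ hm => ?_
    rw [MvPolynomial.notMem_support_iff.1 hm, map_zero]
  conv_lhs => rw [hf]
  rw [hermForm_sum_left]
  exact Finset.sum_congr rfl fun m _ => by rw [hermForm_smul_left, hwf]

theorem hermForm_self_ne_zero {f : PolyRing V} (hf : f ≠ 0) : hermForm b f f ≠ 0 := by
  obtain ⟨w, hw, hwf⟩ := exists_hermForm_eq_sum b
  rw [hwf f f _ subset_rfl]
  have h1 : ∀ m, starRingEnd ℂ (MvPolynomial.coeff m (coordEquiv b f)) *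
      (w m * MvPolynomial.coeff m (coordEquiv b f)) =
      ((w m * Complex.normSq (MvPolynomial.coeff m (coordEquiv b f)) : ℝ) : ℂ) := fun m => by
    rw [Complex.ofReal_mul, Complex.normSq_eq_conj_mul_self]
    ring
  simp only [h1]
  rw [← Complex.ofReal_sum, Complex.ofReal_ne_zero]
  refine (Finset.sum_pos (fun m hm => ?_) ?_).ne'
  · exact mul_pos (hw m) (Complex.normSq_pos.2 (MvPolynomial.mem_support_iff.1 hm))
  · rw [Finset.nonempty_iff_ne_empty, Ne, MvPolynomial.support_eq_empty]
    simpa using hf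

/-- Homogeneous components of different degrees are orthogonal for `hermForm`. -/
theorem hermForm_component_right (d : ℕ) (f h : PolyRing V) :
    hermForm b f (component V d h) = hermForm b (component V d f) (component V d h) := by
  obtain ⟨w, hw, hwf⟩ := exists_hermForm_eq_sum b
  rw [hwf f _ _ subset_rfl, hwf (component V d f) _ (coordEquiv b f).support]
  · refine Finset.sum_congr rfl fun m _ => ?_
    simp only [coordEquiv_component, MvPolynomial.coeff_homogeneousComponent]
    split_ifs <;> simp
  · intro m hm
    rw [MvPolynomial.mem_support_iff, coordEquiv_component,
      MvPolynomial.coeff_homogeneousComponent] at hm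
    rw [MvPolynomial.mem_support_iff]
    split_ifs at hm with h
    · exact hm
    · exact absurd rfl hm

/-- Orthogonal projection onto a finite-dimensional space of polynomials. -/
theorem exists_mem_hermForm_eq (U : Submodule ℂ (PolyRing V)) [FiniteDimensional ℂ U]
    (f : PolyRing V) : ∃ u ∈ U, ∀ u' ∈ U, hermForm b u' (f - u) = 0 := by
  let c := Module.finBasis ℂ U
  let Φ : PolyRing V →ₗ[ℂ] (Fin (finrank ℂ U) → ℂ) :=
    LinearMap.pi fun i => (ev 0).toLinearMap ∘ₗ diffOp V (conjEquiv b (c i))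
  have hΦ : ∀ h i, Φ h i = hermForm b (c i) h := fun _ _ => rfl
  have horth : ∀ h, Φ h = 0 → ∀ u' ∈ U, hermForm b u' h = 0 := by
    intro h hh u' hu'
    have h1 : u' = ∑ i, c.repr ⟨u', hu'⟩ i • (c i : PolyRing V) := by
      conv_lhs => rw [← Submodule.coe_mk u' hu', ← c.sum_repr ⟨u', hu'⟩]
      simp only [Submodule.coe_sum, Submodule.coe_smul]
    rw [h1, hermForm_sum_left]
    refine Finset.sum_eq_zero fun i _ => ?_
    rw [hermForm_smul_left, ← hΦ, hh, Pi.zero_apply, mul_zero]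
  have hinj : Function.Injective (Φ ∘ₗ U.subtype) := by
    rw [injective_iff_map_eq_zero]
    intro u hu
    by_contra hne
    exact hermForm_self_ne_zero b (f := u) (by simpa using hne) (horth _ hu _ u.2)
  obtain ⟨u, hu⟩ := (LinearMap.injective_iff_surjective_of_finrank_eq_finrank (by simp)).1 hinj
    (Φ f)
  refine ⟨u, u.2, horth _ ?_⟩
  rw [map_sub, ← hu]
  exact sub_self _

end Conjugation

/-! ### Polynomials are generated over the invariants by harmonic polynomials -/

section Coinvariants

variable {W V : Type*} [Group W] [AddCommGroup V] [Module ℂ V]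

/-- The ideal of `S` generated by the invariants without constant term. -/
def invariantIdeal (ρ : Representation ℂ W V) : Ideal (PolyRing V) :=
  Ideal.span {r | r ∈ (polyRep ρ).invariants ∧ ev 0 r = 0}

theorem mem_invariantIdeal {ρ : Representation ℂ W V} {r : PolyRing V}
    (hr : r ∈ (polyRep ρ).invariants) (hr0 : ev 0 r = 0) : r ∈ invariantIdeal ρ :=
  Ideal.subset_span ⟨hr, hr0⟩

/-- The component of degree `d` of an element of the invariant ideal is a combination of invariants
without constant term with coefficients of degree less than `d`. -/
theorem component_mem_of_mem_invariantIdeal {ρ : Representation ℂ W V} {d : ℕ}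
    {T : Submodule ℂ (PolyRing V)}
    (hT : ∀ i < d, ∀ a, ∀ r ∈ (polyRep ρ).invariants, ev 0 r = 0 → component V i a * r ∈ T)
    {f : PolyRing V} (hf : f ∈ invariantIdeal ρ) : component V d f ∈ T := by
  induction hf using Submodule.closure_induction with
  | zero => simp
  | add x y _ _ hx hy => rw [map_add]; exact T.add_mem hx hy
  | smul_mem a r hr =>
    rw [smul_eq_mul, component_mul]
    refine T.sum_mem fun p hp => ?_
    rw [Finset.HasAntidiagonal.mem_antidiagonal] at hp
    obtain h0 | h0 := Nat.eq_zero_or_pos p.2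
    · rw [h0, component_zero, hr.2, map_zero, mul_zero]
      exact T.zero_mem
    · refine hT _ (by omega) _ _ (fun g => ?_) ?_
      · rw [← component_polyRep, hr.1 g]
      · exact ev_zero_component h0.ne' _

theorem component_mem_invariantIdeal {ρ : Representation ℂ W V} (d : ℕ) {f : PolyRing V}
    (hf : f ∈ invariantIdeal ρ) : component V d f ∈ invariantIdeal ρ :=
  component_mem_of_mem_invariantIdeal (T := (invariantIdeal ρ).restrictScalars ℂ)
    (fun _ _ _ _ hr hr0 => Ideal.mul_mem_left _ _ (mem_invariantIdeal hr hr0)) hf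

theorem polyRep_mem_invariantIdeal (ρ : Representation ℂ W V) (g : W) {f : PolyRing V}
    (hf : f ∈ invariantIdeal ρ) : polyRep ρ g f ∈ invariantIdeal ρ := by
  induction hf using Submodule.closure_induction with
  | zero => simp
  | add x y _ _ hx hy => rw [map_add]; exact add_mem hx hy
  | smul_mem a r hr =>
    rw [smul_eq_mul, symRep_mul, hr.1 g]
    exact Ideal.mul_mem_left _ _ (mem_invariantIdeal hr.1 hr.2)

/-- A harmonic polynomial is orthogonal to the invariant ideal, so it is zero if it lies in it. -/
theorem disjoint_harmonic_invariantIdeal [Finite W] [FiniteDimensional ℂ V]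
    (ρ : Representation ℂ W V) {f : PolyRing V} (hf : f ∈ (harmonic ρ).toSubmodule)
    (hfI : f ∈ invariantIdeal ρ) : f = 0 := by
  obtain ⟨n, b, hb⟩ := exists_isUnitaryBasis ρ
  by_contra hne
  refine hermForm_self_ne_zero b hne ?_
  rw [mem_harmonic] at hf
  suffices ∀ x ∈ invariantIdeal ρ, hermForm b x f = 0 from this f hfI
  intro x hx
  induction hx using Submodule.closure_induction with
  | zero => simp [hermForm]
  | add x y _ _ hx hy => rw [hermForm_add_left, hx, hy, add_zero]
  | smul_mem a r hr =>
    rw [smul_eq_mul, hermForm_mul_left, hf]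
    · simp [hermForm]
    · intro g
      rw [← conjEquiv_polyRep b hb, hr.1 g]
    · rw [algebraMapInv_conjEquiv, hr.2, map_zero]

/-- A homogeneous polynomial orthogonal to the invariant ideal in its degree is harmonic. -/
theorem mem_harmonic_of_hermForm_eq_zero {n : ℕ} {b : Basis (Fin n) ℂ V}
    {ρ : Representation ℂ W V}
    (hb : IsUnitaryBasis ρ b) {d : ℕ} {f : PolyRing V} (hf : component V d f = f)
    (h : ∀ u ∈ invariantIdeal ρ, component V d u = u → hermForm b u f = 0) :
    f ∈ (harmonic ρ).toSubmodule := by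
  rw [mem_harmonic]
  intro D hD hD0
  obtain ⟨r, rfl⟩ := (conjEquiv b).surjective D
  have hr : r ∈ (polyRep ρ).invariants := fun g =>
    (conjEquiv b).injective (by rw [conjEquiv_polyRep b hb, hD g])
  have hr0 : ev 0 r = 0 := by
    simpa [algebraMapInv_conjEquiv] using hD0
  -- for `D = r̄(∂)`, the polynomial `D f` is orthogonal to itself: `⟨D f, D f⟩ = ⟨D f * r, f⟩`, and
  -- `D f * r` lies in the invariant ideal
  by_contra hne
  refine hermForm_self_ne_zero b hne ?_
  rw [← hermForm_mul_left, ← hf, hermForm_component_right, hf]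
  exact h _ (component_mem_invariantIdeal d
    (Ideal.mul_mem_left _ _ (mem_invariantIdeal hr hr0))) (component_component_self d _)

/-- `S = S^W · H`: a subspace of `S` that contains the harmonic polynomials and is stable under
multiplication by invariants is all of `S`. -/
theorem eq_top_of_harmonic_le [Finite W] [FiniteDimensional ℂ V] (ρ : Representation ℂ W V)
    {T : Submodule ℂ (PolyRing V)} (hH : (harmonic ρ).toSubmodule ≤ T)
    (hT : ∀ t ∈ T, ∀ r ∈ (polyRep ρ).invariants, t * r ∈ T) : T = ⊤ := by
  obtain ⟨n, b, hb⟩ := exists_isUnitaryBasis ρ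
  have key : ∀ d f, component V d f ∈ T := by
    intro d
    induction d using Nat.strong_induction_on with
    | _ d ih =>
      intro f
      let U : Submodule ℂ (PolyRing V) :=
        (invariantIdeal ρ).restrictScalars ℂ ⊓ LinearMap.range (component V d)
      have : FiniteDimensional ℂ U := Submodule.finiteDimensional_of_le inf_le_right
      obtain ⟨u, ⟨huI, u₀, hu₀⟩, hu⟩ := exists_mem_hermForm_eq b U (component V d f)
      have hud : component V d u = u := by rw [← hu₀, component_component_self]
      have h1 : component V d f - u ∈ T := by
        refine hH (mem_harmonic_of_hermForm_eq_zero hb (d := d) ?_ fun u' hu' hu'd =>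
          hu u' ⟨hu', u', hu'd⟩)
        rw [map_sub, component_component_self, hud]
      have h2 : u ∈ T := by
        rw [← hud]
        exact component_mem_of_mem_invariantIdeal
          (fun i hi a r hr _ => hT _ (ih i hi a) r hr) huI
      simpa using T.add_mem h1 h2
  rw [eq_top_iff]
  intro f _
  rw [← sum_component f]
  exact T.sum_mem fun d _ => key d f

end Coinvariants

/-! ### Divided differences and the dimension of the space of harmonic polynomials -/

section DividedDifferences

variable {W V : Type*} [Group W] [AddCommGroup V] [Module ℂ V] {ρ : Representation ℂ W V}

/-- `Δ` is the divided difference operator `f ↦ (f - s f) / α` of some group element `s` and linear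
form `α`. It exists only if `s` acts on `V` trivially or as a reflection with hyperplane
`α = 0`. -/
def IsDividedDifference (ρ : Representation ℂ W V) (Δ : Module.End ℂ (PolyRing V)) : Prop :=
  ∃ (s : W) (α : Dual ℂ V), α ≠ 0 ∧
    ∀ f, SymmetricAlgebra.ι ℂ _ α * Δ f = f - polyRep ρ s f

variable (ρ) in
/-- The algebra of operators on `S` generated by the divided differences. -/
abbrev dividedDifferenceAlg : Subalgebra ℂ (Module.End ℂ (PolyRing V)) :=
  Algebra.adjoin ℂ {Δ | IsDividedDifference ρ Δ}

theorem IsDividedDifference.natDegree_lt {Δ : Module.End ℂ (PolyRing V)}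
    (hΔ : IsDividedDifference ρ Δ) {f : PolyRing V} (hf : Δ f ≠ 0) :
    (dilation V (Δ f)).natDegree < (dilation V f).natDegree := by
  obtain ⟨s, α, hα, h⟩ := hΔ
  have h1 := natDegree_dilation_mul (ι_ne_zero hα) hf
  rw [h, natDegree_dilation_ι hα, map_sub] at h1
  have h2 := Polynomial.natDegree_sub_le (dilation V f) (dilation V (polyRep ρ s f))
  have h3 := natDegree_dilation_polyRep_le ρ s f
  omega

/-- A reflection acts trivially on `V*` modulo the line of linear forms vanishing on its
hyperplane. -/
theorem exists_dual_of_isReflection [FiniteDimensional ℂ V] {s : W} (hs : IsReflection ρ s) :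
    ∃ α : Dual ℂ V, α ≠ 0 ∧ ∀ φ : Dual ℂ V, ∃ c : ℂ, φ - ρ.dual s φ = c • α := by
  set K := LinearMap.ker (ρ s - 1) with hK
  have h1 : finrank ℂ K.dualAnnihilator = 1 := by
    have := Subspace.finrank_add_finrank_dualAnnihilator_eq K
    unfold IsReflection at hs
    rw [← hK] at hs
    omega
  obtain ⟨⟨α, hα⟩, hα0, h⟩ := finrank_eq_one_iff'.1 h1
  refine ⟨α, fun h0 => hα0 (Subtype.ext h0), fun φ => ?_⟩
  have hφ : φ - ρ.dual s φ ∈ K.dualAnnihilator := by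
    rw [Submodule.mem_dualAnnihilator]
    intro x hx
    have hx' : ρ s x = x := by simpa [hK, sub_eq_zero] using hx
    have : ρ s⁻¹ x = x := by
      conv_lhs => rw [← hx']
      simp
    simp [Module.Dual.transpose_apply, this]
  obtain ⟨c, hc⟩ := h ⟨_, hφ⟩
  exact ⟨c, (congrArg Subtype.val hc).symm⟩

theorem ι_dvd_sub_polyRep {s : W} {α : Dual ℂ V}
    (hα : ∀ φ : Dual ℂ V, ∃ c : ℂ, φ - ρ.dual s φ = c • α) (f : PolyRing V) :
    SymmetricAlgebra.ι ℂ _ α ∣ f - polyRep ρ s f := by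
  induction f using SymmetricAlgebra.induction with
  | algebraMap r => simp
  | ι φ =>
    obtain ⟨c, hc⟩ := hα φ
    rw [symRep_ι, ← map_sub, hc, map_smul]
    exact dvd_smul_of_dvd c dvd_rfl
  | mul a b ha hb =>
    have : a * b - polyRep ρ s (a * b) =
        a * (b - polyRep ρ s b) + (a - polyRep ρ s a) * polyRep ρ s b := by
      rw [symRep_mul]; ring
    rw [this]
    exact dvd_add (hb.mul_left _) (ha.mul_right _)
  | add a b ha hb =>
    rw [map_add, add_sub_add_comm]
    exact dvd_add ha hb

theorem exists_dividedDifference [FiniteDimensional ℂ V] {s : W} (hs : IsReflection ρ s) :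
    ∃ (α : Dual ℂ V) (Δ : Module.End ℂ (PolyRing V)), IsDividedDifference ρ Δ ∧
      ∀ f, SymmetricAlgebra.ι ℂ _ α * Δ f = f - polyRep ρ s f := by
  obtain ⟨α, hα0, hα⟩ := exists_dual_of_isReflection hs
  choose q hq using ι_dvd_sub_polyRep hα
  have hcancel := mul_right_injective₀ (ι_ne_zero hα0)
  let Δ : Module.End ℂ (PolyRing V) :=
    { toFun := q
      map_add' := fun f h => hcancel (by
        simp only [mul_add, ← hq, map_add]; ring)
      map_smul' := fun c f => hcancel (by
        simp only [RingHom.id_apply, mul_smul_comm, ← hq, map_smul, smul_sub]) }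
  exact ⟨α, Δ, ⟨s, α, hα0, fun f => (hq f).symm⟩, fun f => (hq f).symm⟩

/-- The functionals `f ↦ (D f)(0)`, for `D` generated by divided differences, separate the points
of the coinvariant algebra. -/
theorem mem_invariantIdeal_of_dividedDifference [FiniteDimensional ℂ V]
    (hρ : IsIrreducibleReflectionGroup ρ) {f : PolyRing V}
    (hf : ∀ D ∈ dividedDifferenceAlg ρ, ev 0 (D f) = 0) : f ∈ invariantIdeal ρ := by
  have := hρ.finite
  have := Fintype.ofFinite W
  induction hn : (dilation V f).natDegree using Nat.strong_induction_on generalizing f with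
  | _ n ih =>
  have hgen : ∀ s, IsReflection ρ s → f - polyRep ρ s f ∈ invariantIdeal ρ := by
    intro s hs
    obtain ⟨α, Δ, hΔ, h⟩ := exists_dividedDifference hs
    rw [← h]
    refine Ideal.mul_mem_left _ _ ?_
    obtain h0 | h0 := eq_or_ne (Δ f) 0
    · rw [h0]; exact zero_mem _
    · refine ih _ (hn ▸ hΔ.natDegree_lt h0) (fun D hD => ?_) rfl
      exact hf (D * Δ) (mul_mem hD (Algebra.subset_adjoin hΔ))
  have hall : ∀ g, f - polyRep ρ g f ∈ invariantIdeal ρ := by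
    intro g
    have hg : g ∈ Subgroup.closure {s | IsReflection ρ s} := by
      rw [hρ.generated]; trivial
    induction hg using Subgroup.closure_induction with
    | mem s hs => exact hgen s hs
    | one => simp
    | mul g h _ _ hg hh =>
      have : f - polyRep ρ (g * h) f =
          (f - polyRep ρ g f) + polyRep ρ g (f - polyRep ρ h f) := by
        rw [map_mul, Module.End.mul_apply, map_sub]; abel
      rw [this]
      exact add_mem hg (polyRep_mem_invariantIdeal ρ g hh)
    | inv g _ hg =>
      have h1 := polyRep_mem_invariantIdeal ρ g⁻¹ hg
      rw [map_sub, ← Module.End.mul_apply, ← map_mul, inv_mul_cancel, map_one,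
        Module.End.one_apply, ← neg_mem_iff, neg_sub] at h1
      exact h1
  have hsum : ∑ g, polyRep ρ g f ∈ invariantIdeal ρ := by
    refine mem_invariantIdeal (fun g => ?_) ?_
    · rw [map_sum]
      refine Fintype.sum_equiv (Equiv.mulLeft g) _ _ fun h => ?_
      rw [Equiv.coe_mulLeft, map_mul, Module.End.mul_apply]
    · rw [map_sum]
      refine Finset.sum_eq_zero fun g _ => ?_
      rw [ev_polyRep, map_zero]
      exact hf 1 (one_mem _)
  have hcard : (Fintype.card W : ℂ) • f ∈ invariantIdeal ρ := by
    have : (Fintype.card W : ℂ) • f = ∑ g, (f - polyRep ρ g f) + ∑ g, polyRep ρ g f := by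
      rw [← Finset.sum_add_distrib]
      simp [← Nat.cast_smul_eq_nsmul ℂ]
    rw [this]
    exact add_mem (sum_mem fun g _ => hall g) hsum
  have h := ((invariantIdeal ρ).restrictScalars ℂ).smul_mem (Fintype.card W : ℂ)⁻¹ hcard
  rwa [smul_smul, inv_mul_cancel₀ (by simp), one_smul] at h

/-- Linear relations over `S` between all the conjugates of a family of polynomials persist under
divided differences. -/
theorem sum_mul_polyRep_eq_zero {ι : Type*} [Fintype ι] {c : ι → PolyRing V}
    {D : Module.End ℂ (PolyRing V)} (hD : D ∈ dividedDifferenceAlg ρ) {y : ι → PolyRing V}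
    (hy : ∀ g, ∑ j, c j * polyRep ρ g (y j) = 0) (g : W) :
    ∑ j, c j * polyRep ρ g (D (y j)) = 0 := by
  induction hD using Algebra.adjoin_induction generalizing y g with
  | mem Δ hΔ =>
    obtain ⟨s, α, hα, h⟩ := hΔ
    have hα' : polyRep ρ g (SymmetricAlgebra.ι ℂ _ α) ≠ 0 :=
      (map_ne_zero_iff _ ((polyRep ρ).apply_bijective g).1).2 (ι_ne_zero hα)
    apply (mul_right_injective₀ hα')
    simp only [mul_zero, Finset.mul_sum]
    have h1 : ∀ j, polyRep ρ g (SymmetricAlgebra.ι ℂ _ α) * (c j * polyRep ρ g (Δ (y j))) =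
        c j * polyRep ρ g (y j) - c j * polyRep ρ (g * s) (y j) := fun j => by
      rw [mul_left_comm, ← symRep_mul, h, map_sub, map_mul, Module.End.mul_apply, mul_sub]
    simp only [h1, Finset.sum_sub_distrib, hy, sub_zero]
  | algebraMap r =>
    simp only [Module.algebraMap_end_apply, map_smul, mul_smul_comm]
    rw [← Finset.smul_sum, hy, smul_zero]
  | add D₁ D₂ _ _ h₁ h₂ =>
    simp only [LinearMap.add_apply, map_add, mul_add, Finset.sum_add_distrib, h₁ hy, h₂ hy,
      add_zero]
  | mul D₁ D₂ _ _ h₁ h₂ =>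
    simp only [Module.End.mul_apply]
    exact h₁ (h₂ hy) g

/-- Over `S`, the conjugates of linearly independent harmonic polynomials satisfy no common
linear relation. -/
theorem eq_zero_of_sum_mul_polyRep_eq_zero [FiniteDimensional ℂ V]
    (hρ : IsIrreducibleReflectionGroup ρ) {ι : Type*} [Fintype ι] {h : ι → PolyRing V}
    (hH : ∀ j, h j ∈ (harmonic ρ).toSubmodule) (hli : LinearIndependent ℂ h)
    {c : ι → PolyRing V} (hc : ∀ g, ∑ j, c j * polyRep ρ g (h j) = 0) : c = 0 := by
  classical
  have := hρ.finite
  let L : dividedDifferenceAlg ρ →ₗ[ℂ] (ι → ℂ) :=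
    { toFun := fun D j => ev 0 (D.1 (h j))
      map_add' := fun _ _ => by ext; simp
      map_smul' := fun _ _ => by ext; simp }
  -- a linear form vanishing on the range of `L` gives an element of `H` in the invariant ideal
  have hL : LinearMap.range L = ⊤ := by
    by_contra hne
    obtain ⟨a, ha0, ha⟩ := Submodule.exists_le_ker_of_lt_top _ (lt_top_iff_ne_top.2 hne)
    have hx : ∀ x, a x = ∑ j, x j * a (Pi.single j 1) := fun x => by
      conv_lhs => rw [pi_eq_sum_univ' x]
      simp
    have hmem : ∑ j, a (Pi.single j 1) • h j ∈ invariantIdeal ρ := by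
      refine mem_invariantIdeal_of_dividedDifference hρ fun D hD => ?_
      have h1 : a (L ⟨D, hD⟩) = 0 := ha ⟨_, rfl⟩
      rw [hx] at h1
      simpa [L, mul_comm] using h1
    have h0 := disjoint_harmonic_invariantIdeal ρ
      (Submodule.sum_mem _ fun j _ => Submodule.smul_mem _ _ (hH j)) hmem
    have h2 := Fintype.linearIndependent_iff.1 hli _ h0
    refine ha0 (LinearMap.ext fun x => ?_)
    rw [hx]
    simp [h2]
  have hD : ∀ i, ∃ D ∈ dividedDifferenceAlg ρ, ∀ j, ev 0 (D (h j)) = if i = j then 1 else 0 := by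
    intro i
    obtain ⟨D, hD⟩ := LinearMap.range_eq_top.1 hL (Pi.single i 1)
    refine ⟨D.1, D.2, fun j => ?_⟩
    have := congrFun hD j
    rw [Pi.single_apply] at this
    simpa [L, eq_comm] using this
  choose D hDmem hD using hD
  let A : Matrix ι ι (PolyRing V) := fun i j => D i (h j)
  -- `A` specialises at the origin to the identity matrix
  have hdet : A.det ≠ 0 := fun h0 => by
    have h1 : (ev (0 : V)).toRingHom.mapMatrix A = 1 := by
      ext i j
      exact hD i j
    have h2 := congrArg Matrix.det h1
    rw [← RingHom.map_det, h0] at h2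
    simp at h2
  by_contra hne
  refine hdet (Matrix.exists_mulVec_eq_zero_iff.1 ⟨c, hne, ?_⟩)
  ext1 i
  have h1 := sum_mul_polyRep_eq_zero (hDmem i) hc 1
  simp only [map_one, Module.End.one_apply] at h1
  simpa [Matrix.mulVec, dotProduct, A, mul_comm] using h1

/-- Chevalley's bound: `dim H ≤ |W|`. -/
theorem card_le_of_linearIndependent_harmonic [FiniteDimensional ℂ V] [Fintype W]
    (hρ : IsIrreducibleReflectionGroup ρ) {ι : Type*} [Fintype ι] {h : ι → PolyRing V}
    (hH : ∀ j, h j ∈ (harmonic ρ).toSubmodule) (hli : LinearIndependent ℂ h) :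
    Fintype.card ι ≤ Fintype.card W := by
  let A : Matrix W ι (PolyRing V) := fun g j => polyRep ρ g (h j)
  refine card_le_of_injective (PolyRing V) A.mulVecLin ?_
  rw [injective_iff_map_eq_zero]
  intro c hc
  refine eq_zero_of_sum_mul_polyRep_eq_zero hρ hH hli fun g => ?_
  have h1 := congrFun hc g
  rw [Matrix.mulVecLin_apply] at h1
  simpa [A, Matrix.mulVec, dotProduct, mul_comm] using h1

end DividedDifferences

/-! ### Evaluation of harmonic polynomials on a regular orbit -/

section RegularOrbit

variable {W V : Type*} [Group W] [AddCommGroup V] [Module ℂ V] [FiniteDimensional ℂ V]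
  {ρ : Representation ℂ W V}

/-- If the translates `f ↦ q (g f)` of a ring homomorphism `q` to a domain are distinct, then they
are linearly independent already on a basis of the harmonic polynomials. On all of `S` this is
Dedekind's independence of characters, and a relation on `H` extends to `S = S^W · H`. -/
theorem eq_zero_of_forall_basis [Fintype W] {R : Type*} [CommRing R] [IsDomain R]
    (q : PolyRing V →+* R)
    (hq : ∀ g h, (∀ f, q (polyRep ρ g f) = q (polyRep ρ h f)) → g = h) {z : W → R}
    {ι : Type*} (b : Basis ι ℂ (harmonic ρ).toSubmodule)
    (hz : ∀ i, ∑ g, z g * q (polyRep ρ g (b i)) = 0) : z = 0 := by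
  have hsmul : ∀ (c : ℂ) (g : W) (f : PolyRing V), z g * q (polyRep ρ g (c • f)) =
      q (algebraMap ℂ _ c) * (z g * q (polyRep ρ g f)) := fun c g f => by
    rw [map_smul, Algebra.smul_def, map_mul, mul_left_comm]
  -- the polynomials satisfying the relation form an `S^W`-submodule of `S` that contains `H`
  let T : Submodule ℂ (PolyRing V) :=
    { carrier := {f | ∑ g, z g * q (polyRep ρ g f) = 0}
      add_mem' := fun {a b} ha hb => by
        simp only [Set.mem_ofPred_eq] at ha hb ⊢
        simp only [map_add, mul_add, Finset.sum_add_distrib, ha, hb, add_zero]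
      zero_mem' := by simp
      smul_mem' := fun c f hf => by
        simp only [Set.mem_ofPred_eq, hsmul] at hf ⊢
        rw [← Finset.mul_sum, hf, mul_zero] }
  have hmem : ∀ f, f ∈ T ↔ ∑ g, z g * q (polyRep ρ g f) = 0 := fun _ => Iff.rfl
  have hH : (harmonic ρ).toSubmodule ≤ T := by
    have h1 : T.comap (harmonic ρ).toSubmodule.subtype = ⊤ := by
      rw [eq_top_iff, ← b.span_eq, Submodule.span_le]
      rintro _ ⟨i, rfl⟩
      exact hz i
    exact fun f hf => (h1 ▸ Submodule.mem_top :
      (⟨f, hf⟩ : (harmonic ρ).toSubmodule) ∈ T.comap (harmonic ρ).toSubmodule.subtype)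
  have hT : T = ⊤ := eq_top_of_harmonic_le ρ hH fun t ht r hr => by
    rw [hmem] at ht ⊢
    simp only [symRep_mul, hr _, map_mul, ← mul_assoc]
    rw [← Finset.sum_mul, ht, zero_mul]
  let F : W → (PolyRing V →* R) := fun g =>
    { toFun := fun f => q (polyRep ρ g f)
      map_one' := by
        rw [← map_one (algebraMap ℂ (PolyRing V)), symRep_algebraMap, map_one, map_one]
      map_mul' := fun a b => by rw [symRep_mul, map_mul] }
  have hF : Function.Injective F := fun g h hgh => hq g h fun f => DFunLike.congr_fun hgh f
  have hli := (linearIndependent_monoidHom (PolyRing V) R).comp F hF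
  refine funext (Fintype.linearIndependent_iff.1 hli z ?_)
  ext f
  have hf : f ∈ T := by rw [hT]; trivial
  rw [hmem] at hf
  simpa [F] using hf

theorem polyRep_faithful (hρ : IsIrreducibleReflectionGroup ρ) {g h : W}
    (hgh : ∀ f, polyRep ρ g f = polyRep ρ h f) : g = h := by
  have h1 : g⁻¹ = h⁻¹ := by
    apply hρ.faithful
    ext x
    refine Module.eval_apply_injective ℂ (LinearMap.ext fun φ => ?_)
    have h2 := hgh (SymmetricAlgebra.ι ℂ _ φ)
    rw [symRep_ι, symRep_ι] at h2
    simpa [Module.Dual.transpose_apply] using DFunLike.congr_fun (ι_injective h2) x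
  exact inv_injective h1

/-- A nontrivial element of `W` fixing a prime divisor of `V` pointwise is a reflection, and the
divisor is its hyperplane. Hence no such divisor passes through a regular vector. -/
theorem eq_one_of_prime_dvd (hρ : IsIrreducibleReflectionGroup ρ) {v : V} (hv : IsRegular ρ v)
    {p : PolyRing V} (hp : Prime p) (hpv : ev v p = 0) {g : W}
    (hg : ∀ f, p ∣ f - polyRep ρ g f) : g = 1 := by
  by_contra hne
  obtain ⟨φ, hφ⟩ : ∃ φ : Dual ℂ V, φ - ρ.dual g φ ≠ 0 := by
    by_contra! h
    refine hne (polyRep_faithful hρ fun f => ?_)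
    rw [map_one, Module.End.one_apply]
    induction f using SymmetricAlgebra.induction with
    | algebraMap r => simp
    | ι φ => rw [symRep_ι, ← sub_eq_zero.1 (h φ)]
    | mul a b ha hb => rw [symRep_mul, ha, hb]
    | add a b ha hb => rw [map_add, ha, hb]
  set ψ := φ - ρ.dual g φ with hψ
  have hpι : ∀ χ : Dual ℂ V, p ∣ SymmetricAlgebra.ι ℂ _ (χ - ρ.dual g χ) := fun χ => by
    rw [map_sub, ← symRep_ι]
    exact hg _
  -- a linear form is irreducible, so `p` is `ψ` up to a unit, and all `χ - g χ` are multiples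
  -- of `ψ`
  have hψp : SymmetricAlgebra.ι ℂ _ ψ ∣ p :=
    (hp.irreducible.associated_of_dvd (irreducible_ι hφ) (hpι φ)).symm.dvd
  have hker : LinearMap.ker (ρ g - 1) = LinearMap.ker ψ := by
    ext x
    have hx : ρ g x = x ↔ ρ g⁻¹ x = x := by
      constructor <;> intro h <;> conv_lhs => rw [← h]
      · simp
      · simp
    rw [LinearMap.mem_ker, LinearMap.mem_ker, LinearMap.sub_apply, Module.End.one_apply,
      sub_eq_zero, hx]
    constructor
    · intro h
      simp [hψ, Module.Dual.transpose_apply, h]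
    · intro h
      refine Module.eval_apply_injective ℂ (LinearMap.ext fun χ => ?_)
      obtain ⟨c, hc⟩ := exists_smul_eq_of_ι_dvd_ι (hψp.trans (hpι χ))
      have h1 := DFunLike.congr_fun hc x
      rw [LinearMap.smul_apply, h, smul_zero, LinearMap.sub_apply, sub_eq_zero] at h1
      simpa [Module.Dual.transpose_apply] using h1.symm
  refine hv g ?_ ?_
  · rw [IsReflection, hker]
    exact Module.Dual.finrank_ker_add_one_of_ne_zero hφ
  · rw [hker, LinearMap.mem_ker]
    obtain ⟨u, hu⟩ := hpι φ
    have h1 := congrArg (ev v) hu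
    rw [map_mul, hpv, zero_mul] at h1
    rwa [ev, SymmetricAlgebra.lift_ι_apply, Module.Dual.eval_apply] at h1

theorem finiteDimensional_harmonic (hρ : IsIrreducibleReflectionGroup ρ) :
    FiniteDimensional ℂ (harmonic ρ).toSubmodule := by
  have := hρ.finite
  have := Fintype.ofFinite W
  refine Module.rank_lt_aleph0_iff.1 (lt_of_le_of_lt (rank_le (n := Fintype.card W)
    fun s hs => ?_) (Cardinal.natCast_lt_aleph0))
  rw [← Fintype.card_coe]
  exact card_le_of_linearIndependent_harmonic hρ (fun i : s => i.1.2)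
    (hs.map' _ (Submodule.ker_subtype _))

theorem finrank_harmonic [Fintype W] (hρ : IsIrreducibleReflectionGroup ρ) :
    finrank ℂ (harmonic ρ).toSubmodule = Fintype.card W := by
  have := finiteDimensional_harmonic hρ
  have b := Module.finBasis ℂ (harmonic ρ).toSubmodule
  apply le_antisymm
  · simpa only [Fintype.card_fin] using card_le_of_linearIndependent_harmonic hρ
      (h := fun i => (b i : PolyRing V)) (fun i => (b i).2)
      (b.linearIndependent.map' _ (Submodule.ker_subtype _))
  · let A : Matrix W (Fin (finrank ℂ (harmonic ρ).toSubmodule)) (PolyRing V) :=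
      fun g j => polyRep ρ g (b j)
    have hinj : Function.Injective A.vecMulLinear := by
      rw [injective_iff_map_eq_zero]
      intro z hz
      exact eq_zero_of_forall_basis (ρ := ρ) (RingHom.id _) (fun g h => polyRep_faithful hρ) b
        fun j => congrFun hz j
    simpa only [Fintype.card_fin] using card_le_of_injective (PolyRing V) A.vecMulLinear hinj

/-- The matrix of the values of a basis of the harmonic polynomials on a regular orbit is
invertible. Before evaluation its determinant is a polynomial, and a prime divisor of it is
the hyperplane of a reflection. -/
theorem det_ev_polyRep_ne_zero [Fintype W] [DecidableEq W] (hρ : IsIrreducibleReflectionGroup ρ)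
    {v : V} (hv : IsRegular ρ v) (b : Basis W ℂ (harmonic ρ).toSubmodule) :
    (Matrix.of fun g k : W => ev v (polyRep ρ g (b k))).det ≠ 0 := by
  let A : Matrix W W (PolyRing V) := Matrix.of fun g k => polyRep ρ g (b k)
  have key : ∀ {R : Type _} [CommRing R] [IsDomain R] (q : PolyRing V →+* R),
      (∀ g h, (∀ f, q (polyRep ρ g f) = q (polyRep ρ h f)) → g = h) → q A.det ≠ 0 := by
    intro R _ _ q hq h0
    rw [RingHom.map_det] at h0
    obtain ⟨z, hz0, hz⟩ := Matrix.exists_vecMul_eq_zero_iff.2 h0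
    exact hz0 (eq_zero_of_forall_basis (ρ := ρ) q hq b fun j => congrFun hz j)
  have hdet : A.det ≠ 0 := key (RingHom.id _) fun g h => polyRep_faithful hρ
  have hev : (Matrix.of fun g k : W => ev v (polyRep ρ g (b k))).det = ev v A.det := by
    rw [AlgHom.map_det]
    rfl
  rw [hev]
  intro h0
  obtain ⟨s, hs, hprod⟩ := UniqueFactorizationMonoid.exists_prime_factors A.det hdet
  have h1 : ev v s.prod = 0 := by
    obtain ⟨u, hu⟩ := hprod.symm
    rw [← hu, map_mul, h0, zero_mul]
  rw [map_multiset_prod, Multiset.prod_eq_zero_iff, Multiset.mem_map] at h1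
  obtain ⟨p, hps, hpv⟩ := h1
  have hp := hs p hps
  have : (Ideal.span {p}).IsPrime := (Ideal.span_singleton_prime hp.ne_zero).2 hp
  refine key (Ideal.Quotient.mk (Ideal.span {p})) (fun g h hgh => ?_) ?_
  · have h2 : h * g⁻¹ = 1 := eq_one_of_prime_dvd hρ hv hp hpv fun f => by
      have h3 := hgh (polyRep ρ g⁻¹ f)
      rw [Ideal.Quotient.eq, Ideal.mem_span_singleton, ← Module.End.mul_apply, ← map_mul,
        ← Module.End.mul_apply, ← map_mul, mul_inv_cancel, map_one, Module.End.one_apply] at h3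
      exact h3
    exact (mul_inv_eq_one.1 h2).symm
  · rw [Ideal.Quotient.eq_zero_iff_mem, Ideal.mem_span_singleton]
    exact (Multiset.dvd_prod hps).trans hprod.dvd

end RegularOrbit

section OrbitEval

variable {W V : Type*} [Group W] [AddCommGroup V] [Module ℂ V] {ρ : Representation ℂ W V}

/-- The restriction of harmonic polynomials to the orbit of `v`, as functions on the group:
`f ↦ (g ↦ f (g⁻¹ v))`. -/
def orbitEval (ρ : Representation ℂ W V) (v : V) : (harmonic ρ).toSubmodule →ₗ[ℂ] (W → ℂ) :=
  LinearMap.pi fun g => (ev v).toLinearMap ∘ₗ polyRep ρ g ∘ₗ (harmonic ρ).toSubmodule.subtype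

theorem orbitEval_apply (v : V) (f : (harmonic ρ).toSubmodule) (g : W) :
    orbitEval ρ v f g = ev v (polyRep ρ g f) := rfl

theorem orbitEval_bijective [FiniteDimensional ℂ V] (hρ : IsIrreducibleReflectionGroup ρ) {v : V}
    (hv : IsRegular ρ v) :
    Function.Bijective (orbitEval ρ v) := by
  classical
  have := hρ.finite
  have := Fintype.ofFinite W
  have := finiteDimensional_harmonic hρ
  have hfr := finrank_harmonic hρ
  have b : Basis W ℂ (harmonic ρ).toSubmodule :=
    (Module.finBasis ℂ (harmonic ρ).toSubmodule).reindex
      (Fintype.equivOfCardEq (by simpa using hfr))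
  have hinj : Function.Injective (orbitEval ρ v) := by
    rw [injective_iff_map_eq_zero]
    intro f hf
    have h0 : (b.repr f : W → ℂ) = 0 := by
      refine Matrix.eq_zero_of_mulVec_eq_zero (det_ev_polyRep_ne_zero hρ hv b) ?_
      ext g
      have h1 := congrFun hf g
      rw [← b.sum_repr f, map_sum, Finset.sum_apply] at h1
      refine Eq.trans (Finset.sum_congr rfl fun k _ => ?_) h1
      rw [map_smul, Pi.smul_apply, orbitEval_apply, smul_eq_mul]
      exact mul_comm (ev v (polyRep ρ g (b k))) (b.repr f k)
    exact b.repr.map_eq_zero_iff.1 (DFunLike.coe_injective h0)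
  exact ⟨hinj, (LinearMap.injective_iff_surjective_of_finrank_eq_finrank (by simp [hfr])).1 hinj⟩

end OrbitEval

/-! ### The pairing -/

section Pairing

variable {W V M : Type*} [Group W] [AddCommGroup V] [Module ℂ V]
  [AddCommGroup M] [Module ℂ M] {ρ : Representation ℂ W V}

/-- The map `Hom_W(M, H) → M*`, `φ ↦ ev_v ∘ φ`. -/
def homEval (ρ : Representation ℂ W V) (τ : Representation ℂ W M) (v : V) :
    τ.IntertwiningMap (harmonicRep ρ) →ₗ[ℂ] Dual ℂ M where
  toFun φ := (ev v).toLinearMap ∘ₗ (harmonic ρ).toSubmodule.subtype ∘ₗ φ.toLinearMap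
  map_add' _ _ := by ext; simp
  map_smul' _ _ := by ext; simp

theorem homEval_apply (τ : Representation ℂ W M) (v : V)
    (φ : τ.IntertwiningMap (harmonicRep ρ)) (m : M) :
    homEval ρ τ v φ m = ev v (φ m : PolyRing V) := rfl

theorem orbitEval_intertwiningMap (τ : Representation ℂ W M) (v : V)
    (φ : τ.IntertwiningMap (harmonicRep ρ)) (m : M) (g : W) :
    orbitEval ρ v (φ m) g = homEval ρ τ v φ (τ g m) := by
  rw [orbitEval_apply, homEval_apply]
  exact congrArg (ev v) (congrArg Subtype.val (φ.isIntertwining _ _ g m)).symm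

/-- Frobenius reciprocity: since `H` is the space of functions on a regular orbit,
`Hom_W(M, H)` is `M*`. -/
theorem homEval_bijective [FiniteDimensional ℂ V] (hρ : IsIrreducibleReflectionGroup ρ)
    (τ : Representation ℂ W M) {v : V} (hv : IsRegular ρ v) :
    Function.Bijective (homEval ρ τ v) := by
  constructor
  · rw [injective_iff_map_eq_zero]
    intro φ hφ
    ext m
    apply congrArg Subtype.val
    refine (orbitEval_bijective hρ hv).1 ?_
    ext g
    simp [orbitEval_intertwiningMap, hφ]
  · intro ξ
    let E := LinearEquiv.ofBijective (orbitEval ρ v) (orbitEval_bijective hρ hv)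
    let Φ : M →ₗ[ℂ] (harmonic ρ).toSubmodule :=
      E.symm.toLinearMap ∘ₗ LinearMap.pi fun g => ξ ∘ₗ τ g
    have hΦ : ∀ m g, ev v (polyRep ρ g (Φ m)) = ξ (τ g m) := fun m g =>
      congrFun (E.apply_symm_apply _) g
    refine ⟨⟨Φ, fun h => ?_⟩, ?_⟩
    · ext1 m
      refine (orbitEval_bijective hρ hv).1 ?_
      ext g
      change ev v (polyRep ρ g (Φ (τ h m))) = ev v (polyRep ρ g (polyRep ρ h (Φ m)))
      have h1 : polyRep ρ g (polyRep ρ h (Φ m)) = polyRep ρ (g * h) (Φ m) := by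
        rw [map_mul, Module.End.mul_apply]
      rw [h1, hΦ, hΦ, map_mul, Module.End.mul_apply]
    · ext m
      have := hΦ m 1
      rw [map_one, map_one] at this
      exact this

theorem pairingAt_apply [FiniteDimensional ℂ M] (τ : Representation ℂ W M) (v : V)
    (φ : τ.IntertwiningMap (harmonicRep ρ)) (ψ : τ.dual.IntertwiningMap (harmonicRep ρ)) :
    pairingAt ρ τ v φ ψ = homEval ρ τ.dual v ψ (homEval ρ τ v φ) := by
  let b := Basis.ofVectorSpace ℂ M
  rw [← b.sum_dual_apply_smul_coord (homEval ρ τ v φ), map_sum]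
  change ev v (productHom ρ τ φ ψ (coevaluation ℂ M 1)) = _
  rw [coevaluation_apply_one, map_sum, map_sum]
  refine Finset.sum_congr rfl fun i _ => ?_
  rw [map_smul, homEval_apply, homEval_apply, smul_eq_mul, ← map_mul]
  rfl

end Pairing

end ReflectionGroup

end

theorem proposition1 {W V M : Type*} [Group W]
    [AddCommGroup V] [Module ℂ V] [FiniteDimensional ℂ V]
    [AddCommGroup M] [Module ℂ M] [FiniteDimensional ℂ M]
    (ρ : Representation ℂ W V) (hρ : ReflectionGroup.IsIrreducibleReflectionGroup ρ)
    (τ : Representation ℂ W M) (v : V) (hv : ReflectionGroup.IsRegular ρ v) :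
    LinearMap.IsPerfPair (R := ℂ) (M := τ.IntertwiningMap (ReflectionGroup.harmonicRep ρ))
      (N := τ.dual.IntertwiningMap (ReflectionGroup.harmonicRep ρ))
      (ReflectionGroup.pairingAt ρ τ v) := by
  let e := LinearEquiv.ofBijective _ (ReflectionGroup.homEval_bijective hρ τ hv)
  let e' := LinearEquiv.ofBijective _ (ReflectionGroup.homEval_bijective hρ τ.dual hv)
  have h : ReflectionGroup.pairingAt ρ τ v =
      (Module.Dual.eval ℂ (Module.Dual ℂ M)).compl₁₂ e.toLinearMap e'.toLinearMap := by
    ext φ ψ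
    exact ReflectionGroup.pairingAt_apply τ v φ ψ
  rw [h]
  infer_instance
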